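/- All digraphs are reflexive. Let $n\ge 3$ and let $\mathbb{G}$ be an $n$-cycle, i.e. a reflexive digraph on $\{0,\dots,n-1\}$ in which two distinct vertices are joined by an arc (in one or both directions) if and only if they are consecutive modulo $n$. A path of length $k$ is a reflexive digraph on $\{0,\dots,k\}$ in which two distinct vertices $i,j$ are joined by an arc (in one or both directions) if and only if $|i-j|=1$. Paths of length $k$ correspond to words of length $k$ over $\{+,-,*\}$, the $i$-th letter being $+$, $-$ or $*$ according to whether the arcs between $i-1$ and $i$ are $(i-1,i)$ only, $(i,i-1)$ only, or both. For words (or paths) $U,V$ write $U\le V$ if there is a homomorphism from the path of $V$ onto the path of $U$ that sends first vertex to first vertex and last vertex to last vertex. An induced subpath of $\mathbb{G}$ of length $n-2$ is a path of length $n-2$ isomorphic to an induced subdigraph of $\mathbb{G}$. A subpath of $\mathbb{G}$ of length $n-1$ is a path $\mathbb{P}$ of length $n-1$ admitting an injective map $e$ of its vertices into those of $\mathbb{G}$ such that, for consecutive vertices $i,j$ of $\mathbb{P}$, $(i,j)$ is an arc of $\mathbb{P}$ if and only if $(e(i),e(j))$ is an arc of $\mathbb{G}$ (thus $\mathbb{P}$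 is $\mathbb{G}$ with the arc or arcs between one pair of consecutive vertices removed, read in either direction). $\mathbb{G}$ satisfies the path condition if there is no surjective homomorphism $\prod_i\mathbb{Q}_i\to\mathbb{G}$ from a finite product of induced subpaths $\mathbb{Q}_i$ of $\mathbb{G}$ of length $n-2$. Consider the statements: 1. $\mathbb{G}$ satisfies the path condition; 2. for every subpath $\mathbb{P}$ of $\mathbb{G}$ of length $n-1$ there is a word $W$ such that $W\ge\mathbb{Q}$ for every induced subpath $\mathbb{Q}$ of $\mathbb{G}$ of length $n-2$, but $W\not\ge\mathbb{P}$. Then (1) implies (2). If moreover $n\ge 4$, or $\mathbb{G}$ is the directed 3-cycle (no symmetric edge, all arcs between distinct vertices going around in the same direction), then (1) and (2) are equivalent. -/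

import Mathlib

namespace ReflexiveCycle

/-- A path of length `k`: a reflexive digraph on `{0, …, k}` in which two distinct vertices are
joined by an arc (in one or both directions) exactly when they are consecutive. -/
def IsPath {k : ℕ} (P : Digraph (Fin (k + 1))) : Prop :=
  (∀ i, P.Adj i i) ∧
  ∀ i j : Fin (k + 1), i ≠ j →
    ((P.Adj i j ∨ P.Adj j i) ↔ (j.val = i.val + 1 ∨ i.val = j.val + 1))

/-- An `n`-cycle, `n ≥ 3`: a reflexive digraph on `{0, …, n - 1}` in which two distinct vertices
are joined by an arc (in one or both directions) exactly when they are consecutive modulo `n`. -/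
def IsCycle {n : ℕ} (G : Digraph (Fin n)) : Prop :=
  3 ≤ n ∧ (∀ i, G.Adj i i) ∧
  ∀ i j : Fin n, i ≠ j →
    ((G.Adj i j ∨ G.Adj j i) ↔ (j.val = (i.val + 1) % n ∨ i.val = (j.val + 1) % n))

/-- All arcs between distinct vertices of the cycle `G` go around in the same direction,
and none of them is symmetric. -/
def IsDirectedCycle {n : ℕ} (G : Digraph (Fin n)) : Prop :=
  IsCycle G ∧
  ((∀ i j : Fin n, j.val = (i.val + 1) % n → G.Adj i j ∧ ¬ G.Adj j i) ∨
   (∀ i j : Fin n, j.val = (i.val + 1) % n → G.Adj j i ∧ ¬ G.Adj i j))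

/-- The product of a family of digraphs. -/
def prodDigraph {ι : Type*} {V : ι → Type*} (Q : ∀ i, Digraph (V i)) : Digraph (∀ i, V i) where
  Adj x y := ∀ i, (Q i).Adj (x i) (y i)

/-- `H` embeds in `G`: it is isomorphic to an induced subdigraph of `G`. -/
def Embeds {V W : Type*} (H : Digraph V) (G : Digraph W) : Prop :=
  Nonempty (H.Adj ↪r G.Adj)

/-- The path `P` of length `k` is a subpath of `G`: its vertices are placed injectively in `G`, and
between consecutive vertices `P` has exactly the same arcs as `G`. Arcs of `G` between the images
of non-consecutive vertices are allowed; in an `n`-cycle they can occur only for `k = n - 1`, where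
`P` is the cycle with the arc or arcs between one pair of consecutive vertices removed. -/
def IsSubpath {k : ℕ} {V : Type*} (P : Digraph (Fin (k + 1))) (G : Digraph V) : Prop :=
  IsPath P ∧ ∃ e : Fin (k + 1) → V, Function.Injective e ∧
    ∀ i j : Fin (k + 1), (j.val = i.val + 1 ∨ i.val = j.val + 1) →
      (P.Adj i j ↔ G.Adj (e i) (e j))

/-- The alphabet `{+, -, *}`. -/
inductive Letter
  | plus
  | minus
  | star

/-- Words on the alphabet `{+, -, *}`. -/
abbrev Word := List Letter

/-- The path `P(W)` associated to a word `W`: the `i`-th letter (counting from `0`) gives the arc or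
arcs between the vertices `i` and `i + 1`. -/
def pathOf (W : Word) : Digraph (Fin (W.length + 1)) where
  Adj i j := i = j ∨
    (j.val = i.val + 1 ∧ (W[i.val]? = some Letter.plus ∨ W[i.val]? = some Letter.star)) ∨
    (i.val = j.val + 1 ∧ (W[j.val]? = some Letter.minus ∨ W[j.val]? = some Letter.star))

open Classical in
/-- The word `w(P)` of a path `P` of length `k`. -/
noncomputable def wordOf {k : ℕ} (P : Digraph (Fin (k + 1))) : Word :=
  List.ofFn fun i : Fin k =>
    if P.Adj i.castSucc i.succ then
      if P.Adj i.succ i.castSucc then Letter.star else Letter.plus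
    else Letter.minus

/-- The ordering of words: `U ≤ V` if there is an end-point preserving homomorphism from `P(V)`
onto `P(U)`. -/
def WordLE (U V : Word) : Prop :=
  ∃ f : (pathOf V).Adj →r (pathOf U).Adj,
    f 0 = 0 ∧ f (Fin.last V.length) = Fin.last U.length ∧ Function.Surjective f

/-- The path condition: no finite product of paths of length `n - 2` that embed in the `n`-cycle `G`
admits a homomorphism onto `G`. -/
def PathCondition {n : ℕ} (G : Digraph (Fin n)) : Prop :=
  ¬ ∃ (l : ℕ) (Q : Fin l → Digraph (Fin (n - 2 + 1))),
    (∀ i, IsPath (Q i) ∧ Embeds (Q i) G) ∧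
    ∃ f : (prodDigraph Q).Adj →r G.Adj, Function.Surjective f

/-- For every subpath `P` of length `n - 1` some word lies above all induced subpaths of
length `n - 2`, but not above `P`. -/
def WordCondition {n : ℕ} (G : Digraph (Fin n)) : Prop :=
  ∀ P : Digraph (Fin (n - 1 + 1)), IsSubpath P G →
    ∃ W : Word,
      (∀ Q : Digraph (Fin (n - 2 + 1)), IsPath Q → Embeds Q G → WordLE (wordOf Q) W) ∧
      ¬ WordLE (wordOf P) W

end ReflexiveCycle

/-!
For the first implication, let `∏ Qᵢ` be the product of all induced subpaths of length `n - 2`. If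
every word above all `Qᵢ` is above `P`, then every word that can be walked in the product from `⊥`
to `⊤` can be walked from end to end in `P`. Mapping a vertex `x` of the product to the least, over
the words `W` leading from `⊥` to `x`, of the farthest vertex of `P` attainable by `W`, is then a
homomorphism onto `P`, and `P` maps bijectively to the cycle.

Conversely, a product of paths contracts to a point through single moves along arcs, and for
`4 ≤ n` such homotopies lift to the universal cover `ℤ` of the cycle. A surjection of the product
onto the cycle thus lifts to an integer-valued map whose range has width at least `n - 1`; cutting
it off at width `n - 1` gives a homomorphism of the product onto a subpath `P` of length `n - 1`,
reaching both ends. Any word above all `Qᵢ` can be walked between any two vertices of the product,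
hence from end to end in `P`. The directed `3`-cycle satisfies the path condition outright: a
product of paths of length `1` has vertices dominating and dominated by all others, while every
transitive triangle of the directed `3`-cycle is degenerate.
-/

namespace ReflexiveCycle

section Walks

variable {V V' : Type*} {D : Digraph V} {D' : Digraph V'} {W : Word} {l : Letter} {x y z : V}

/-- A step from `x` to `y` in `D` of the shape prescribed by a letter. Further arcs between `x`
and `y` are allowed, so that steps are preserved by homomorphisms. -/
def Step (D : Digraph V) : Letter → V → V → Prop
  | Letter.plus, x, y => D.Adj x y
  | Letter.minus, x, y => D.Adj y x
  | Letter.star, x, y => D.Adj x y ∧ D.Adj y x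

/-- Some walk in `D` from `x` to `y` follows the letters of the word; equivalently, `x` and `y`
are the images of the end vertices under a homomorphism from the path of the word to `D`. -/
def HasWalk (D : Digraph V) : Word → V → V → Prop
  | [], x, y => x = y
  | l :: W, x, y => ∃ z, Step D l x z ∧ HasWalk D W z y

theorem Step.adj_or_adj (h : Step D l x y) : D.Adj x y ∨ D.Adj y x := by
  cases l
  exacts [.inl h, .inr h, .inl h.1]

theorem exists_step_of_adj_or_adj (h : D.Adj x y ∨ D.Adj y x) : ∃ l, Step D l x y :=
  h.elim (⟨.plus, ·⟩) (⟨.minus, ·⟩)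

theorem Step.map (f : D.Adj →r D'.Adj) (h : Step D l x y) : Step D' l (f x) (f y) := by
  cases l
  exacts [f.map_rel h, f.map_rel h, ⟨f.map_rel h.1, f.map_rel h.2⟩]

theorem HasWalk.map (f : D.Adj →r D'.Adj) (h : HasWalk D W x y) : HasWalk D' W (f x) (f y) := by
  induction W generalizing x with
  | nil => exact congrArg f h
  | cons l W ih =>
    obtain ⟨z, hl, hz⟩ := h
    exact ⟨f z, hl.map f, ih hz⟩

theorem hasWalk_concat_iff :
    HasWalk D (W ++ [l]) x z ↔ ∃ y, HasWalk D W x y ∧ Step D l y z := by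
  induction W generalizing x with
  | nil => simp [HasWalk]
  | cons l' W ih => simp only [List.cons_append, HasWalk, ih]; tauto

theorem hasWalk_iff_exists_seq :
    HasWalk D W x y ↔ ∃ c : ℕ → V, c 0 = x ∧ c W.length = y ∧
      ∀ i (h : i < W.length), Step D W[i] (c i) (c (i + 1)) := by
  induction W generalizing x with
  | nil => exact ⟨fun h => ⟨fun _ => x, rfl, h, by simp⟩, fun ⟨_, h0, h1, _⟩ => h0.symm.trans h1⟩
  | cons l W ih =>
    simp only [HasWalk, ih]
    constructor
    · rintro ⟨z, hl, c, rfl, rfl, hc⟩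
      refine ⟨fun i => i.casesOn x c, rfl, rfl, fun i hi => ?_⟩
      cases i with
      | zero => exact hl
      | succ i => exact hc i (Nat.lt_of_succ_lt_succ hi)
    · rintro ⟨c, rfl, rfl, hc⟩
      exact ⟨c 1, hc 0 (Nat.zero_lt_succ _), fun i => c (i + 1), rfl, rfl,
        fun i hi => hc (i + 1) (Nat.succ_lt_succ hi)⟩

variable {ι : Type*} {U : ι → Type*} {Q : ∀ i, Digraph (U i)}

theorem step_prodDigraph_iff {x y : ∀ i, U i} :
    Step (prodDigraph Q) l x y ↔ ∀ i, Step (Q i) l (x i) (y i) := by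
  cases l
  exacts [Iff.rfl, Iff.rfl, forall_and.symm]

theorem hasWalk_prodDigraph_iff {x y : ∀ i, U i} :
    HasWalk (prodDigraph Q) W x y ↔ ∀ i, HasWalk (Q i) W (x i) (y i) := by
  induction W generalizing x with
  | nil => exact funext_iff
  | cons l W ih =>
    simp only [HasWalk, step_prodDigraph_iff, ih, ← forall_and, Classical.skolem]

end Walks

section Paths

variable {k : ℕ} {P : Digraph (Fin (k + 1))} {u v : Fin (k + 1)}

namespace IsPath

theorem val_le_of_adj (hP : IsPath P) (h : P.Adj u v) : u.val ≤ v + 1 ∧ v.val ≤ u + 1 := by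
  by_cases huv : u = v
  · simp [huv]
  · have := (hP.2 u v huv).1 (.inl h)
    omega

theorem adj_or_adj (hP : IsPath P) (h : v.val = u + 1) : P.Adj u v ∨ P.Adj v u :=
  (hP.2 u v (by rintro rfl; omega)).2 (.inl h)

theorem adj_inf (hP : IsPath P) (b : Fin (k + 1)) (h : P.Adj u v) : P.Adj (u ⊓ b) (v ⊓ b) := by
  obtain hfix | heq : (u ⊓ b = u ∧ v ⊓ b = v) ∨ u ⊓ b = v ⊓ b := by
    have := hP.val_le_of_adj h
    simp only [Fin.ext_iff, Fin.coe_min]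
    omega
  · rwa [hfix.1, hfix.2]
  · exact heq ▸ hP.1 _

theorem adj_sup (hP : IsPath P) (b : Fin (k + 1)) (h : P.Adj u v) : P.Adj (u ⊔ b) (v ⊔ b) := by
  obtain hfix | heq : (u ⊔ b = u ∧ v ⊔ b = v) ∨ u ⊔ b = v ⊔ b := by
    have := hP.val_le_of_adj h
    simp only [Fin.ext_iff, Fin.coe_max]
    omega
  · rwa [hfix.1, hfix.2]
  · exact heq ▸ hP.1 _

theorem adj_inf_or_adj_inf_of_covBy (hP : IsPath P) {t t' : Fin (k + 1)} (ht : t ⋖ t')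
    (h : P.Adj u v) : P.Adj (u ⊓ t) (v ⊓ t') ∨ P.Adj (u ⊓ t') (v ⊓ t) := by
  rw [Fin.covBy_iff, Nat.covBy_iff_add_one_eq] at ht
  obtain hu | hv | ⟨hu, hv, hu', hv'⟩ : u ⊓ t' = u ⊓ t ∨ v ⊓ t' = v ⊓ t ∨
      u ⊓ t = t ∧ v ⊓ t = t ∧ u ⊓ t' = t' ∧ v ⊓ t' = t' := by
    simp only [Fin.ext_iff, Fin.coe_min]
    omega
  · exact .inr (hu ▸ hP.adj_inf t h)
  · exact .inl (hv ▸ hP.adj_inf t h)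
  · rw [hu, hv, hu', hv']
    exact hP.adj_or_adj ht.symm

theorem mem_range_of_hasWalk (hP : IsPath P) {V : Type*} {D : Digraph V} (f : D.Adj →r P.Adj)
    {W : Word} {a b : V} (h : HasWalk D W a b) {s : Fin (k + 1)} (ha : f a ≤ s) (hb : s ≤ f b) :
    s ∈ Set.range f := by
  induction W generalizing a with
  | nil =>
    obtain rfl : a = b := h
    exact ⟨a, le_antisymm ha hb⟩
  | cons l W ih =>
    obtain ⟨z, hl, hz⟩ := h
    rcases le_or_gt (f z) s with hzs | hsz
    · exact ih hz hzs
    · have hval : (f z).val ≤ f a + 1 := by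
        rcases hl.adj_or_adj with h | h
        · exact (hP.val_le_of_adj (f.map_rel h)).2
        · exact (hP.val_le_of_adj (f.map_rel h)).1
      exact ⟨a, le_antisymm ha (by simp only [Fin.le_def, Fin.lt_def] at *; omega)⟩

theorem surjective_of_hasWalk (hP : IsPath P) {V : Type*} {D : Digraph V} (f : D.Adj →r P.Adj)
    {W : Word} {a b : V} (h : HasWalk D W a b) (ha : f a = ⊥) (hb : f b = ⊤) :
    Function.Surjective f := fun _ =>
  hP.mem_range_of_hasWalk f h (ha ▸ bot_le) (hb ▸ le_top)

end IsPath

/-- The path `P` read backwards. -/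
def reverse (P : Digraph (Fin (k + 1))) : Digraph (Fin (k + 1)) where
  Adj i j := P.Adj i.rev j.rev

theorem IsPath.reverse (hP : IsPath P) : IsPath (reverse P) := by
  refine ⟨fun i => hP.1 _, fun i j hij => (hP.2 i.rev j.rev (Fin.rev_injective.ne hij)).trans ?_⟩
  rw [Fin.val_rev, Fin.val_rev]
  omega

theorem Embeds.reverse {V : Type*} {G : Digraph V} (h : Embeds P G) : Embeds (reverse P) G := by
  obtain ⟨e⟩ := h
  exact ⟨⟨Fin.revPerm.toEmbedding.trans e.toEmbedding, e.map_rel_iff⟩⟩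

theorem IsPath.hasWalk_of_reverse (hP : IsPath P) {W : Word} (h : HasWalk P W ⊥ ⊤)
    (hrev : HasWalk (ReflexiveCycle.reverse P) W ⊥ ⊤) (a b : Fin (k + 1)) : HasWalk P W a b := by
  let clamp (lo hi : Fin (k + 1)) : P.Adj →r P.Adj :=
    ⟨fun u => u ⊓ hi ⊔ lo, fun h => hP.adj_sup lo (hP.adj_inf hi h)⟩
  let rev : (ReflexiveCycle.reverse P).Adj →r P.Adj := ⟨Fin.rev, id⟩
  rcases le_total a b with hab | hba
  · simpa [clamp, hab] using h.map (clamp a b)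
  · have hwalk : HasWalk P W (Fin.rev ⊥) (Fin.rev ⊤) := hrev.map rev
    rw [Fin.rev_bot, Fin.rev_top] at hwalk
    simpa [clamp, hba] using hwalk.map (clamp b a)

end Paths

section Words

variable {U W : Word}

theorem step_pathOf {i j : Fin (W.length + 1)} (hi : i.val < W.length) (h : j.val = i + 1) :
    Step (pathOf W) W[i.val] i j := by
  have hget : W[i.val]? = some W[i.val] := List.getElem?_eq_getElem hi
  generalize W[i.val] = l at hget
  cases l <;> simp [Step, pathOf, hget, h]

theorem isPath_pathOf (W : Word) : IsPath (pathOf W) := by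
  refine ⟨fun i => .inl rfl, fun i j hij => ⟨?_, ?_⟩⟩
  · rintro ((h | h | h) | (h | h | h)) <;> omega
  · rintro (h | h)
    · exact (step_pathOf (by omega) h).adj_or_adj
    · exact (step_pathOf (by omega) h).adj_or_adj.symm

theorem hasWalk_pathOf (W : Word) : HasWalk (pathOf W) W ⊥ ⊤ := by
  refine hasWalk_iff_exists_seq.2 ⟨Fin.ofNat _, rfl, ?_, fun i hi => ?_⟩
  · ext
    simp
  · have hval : (Fin.ofNat (W.length + 1) i).val = i := Nat.mod_eq_of_lt (by omega)
    have hsucc : (Fin.ofNat (W.length + 1) (i + 1)).val = i + 1 := Nat.mod_eq_of_lt (by omega)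
    simpa only [hval] using step_pathOf (i := Fin.ofNat _ i) (by omega) (hsucc.trans (by rw [hval]))

theorem exists_hom_pathOf {V : Type*} {D : Digraph V} (hD : ∀ x, D.Adj x x) {x y : V}
    (h : HasWalk D W x y) : ∃ f : (pathOf W).Adj →r D.Adj, f ⊥ = x ∧ f ⊤ = y := by
  obtain ⟨c, hc0, hc1, hc⟩ := hasWalk_iff_exists_seq.1 h
  refine ⟨⟨fun i => c i, fun {i j} hij => ?_⟩, hc0, hc1⟩
  rcases hij with rfl | ⟨hj, hl⟩ | ⟨hi, hl⟩
  · exact hD _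
  · have hstep := hc i (by omega)
    rw [List.getElem?_eq_getElem (by omega), Option.some_inj, Option.some_inj] at hl
    rw [hj]
    rcases hl with hl | hl <;> rw [hl] at hstep
    exacts [hstep, hstep.1]
  · have hstep := hc j (by omega)
    rw [List.getElem?_eq_getElem (by omega), Option.some_inj, Option.some_inj] at hl
    rw [hi]
    rcases hl with hl | hl <;> rw [hl] at hstep
    exacts [hstep, hstep.2]

theorem wordLE_iff_hasWalk : WordLE U W ↔ HasWalk (pathOf U) W ⊥ ⊤ := by
  constructor
  · rintro ⟨f, h0, h1, -⟩
    have := (hasWalk_pathOf W).map f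
    rwa [show f ⊥ = ⊥ from h0, show f ⊤ = ⊤ from h1] at this
  · intro h
    obtain ⟨f, h0, h1⟩ := exists_hom_pathOf (isPath_pathOf U).1 h
    exact ⟨f, h0, h1, (isPath_pathOf U).surjective_of_hasWalk f (hasWalk_pathOf W) h0 h1⟩

variable {k : ℕ} {P : Digraph (Fin (k + 1))}

theorem length_wordOf (P : Digraph (Fin (k + 1))) : (wordOf P).length = k :=
  List.length_ofFn

theorem wordOf_getElem?_eq_plus_or_star_iff {i j : Fin (k + 1)} (h : j.val = i + 1) :
    ((wordOf P)[i.val]? = some Letter.plus ∨ (wordOf P)[i.val]? = some Letter.star) ↔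
      P.Adj i j := by
  obtain ⟨i, rfl, rfl⟩ : ∃ m : Fin k, i = m.castSucc ∧ j = m.succ :=
    ⟨⟨i, by omega⟩, rfl, Fin.ext h⟩
  simp only [wordOf, List.getElem?_ofFn, Fin.val_castSucc, i.2, dif_pos, Option.some.injEq]
  split_ifs <;> simp_all

theorem wordOf_getElem?_eq_minus_or_star_iff (hP : IsPath P) {i j : Fin (k + 1)}
    (h : j.val = i + 1) :
    ((wordOf P)[i.val]? = some Letter.minus ∨ (wordOf P)[i.val]? = some Letter.star) ↔
      P.Adj j i := by
  have hor := hP.adj_or_adj h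
  obtain ⟨i, rfl, rfl⟩ : ∃ m : Fin k, i = m.castSucc ∧ j = m.succ :=
    ⟨⟨i, by omega⟩, rfl, Fin.ext h⟩
  simp only [wordOf, List.getElem?_ofFn, Fin.val_castSucc, i.2, dif_pos, Option.some.injEq]
  split_ifs <;> simp_all

theorem pathOf_wordOf_adj_iff (hP : IsPath P) {i j : Fin ((wordOf P).length + 1)} :
    (pathOf (wordOf P)).Adj i j ↔
      P.Adj (i.cast (by rw [length_wordOf])) (j.cast (by rw [length_wordOf])) := by
  have hk : (wordOf P).length + 1 = k + 1 := by rw [length_wordOf]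
  have hplus (h : j.val = i + 1) :=
    wordOf_getElem?_eq_plus_or_star_iff (P := P) (i := i.cast hk) (j := j.cast hk) h
  have hminus (h : i.val = j + 1) :=
    wordOf_getElem?_eq_minus_or_star_iff hP (i := j.cast hk) (j := i.cast hk) h
  constructor
  · rintro (rfl | ⟨h, hl⟩ | ⟨h, hl⟩)
    exacts [hP.1 _, (hplus h).1 hl, (hminus h).1 hl]
  · intro hadj
    by_cases hij : i = j
    · exact .inl hij
    · rcases (hP.2 _ _ ((Fin.cast_injective hk).ne hij)).1 (.inl hadj) with h | h
      exacts [.inr (.inl ⟨h, (hplus h).2 hadj⟩), .inr (.inr ⟨h, (hminus h).2 hadj⟩)]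

theorem wordLE_wordOf_iff (hP : IsPath P) : WordLE (wordOf P) W ↔ HasWalk P W ⊥ ⊤ := by
  have hk : (wordOf P).length + 1 = k + 1 := by rw [length_wordOf]
  let e : (pathOf (wordOf P)).Adj ≃r P.Adj := ⟨finCongr hk, (pathOf_wordOf_adj_iff hP).symm⟩
  have he0 : e ⊥ = ⊥ := rfl
  have he1 : e ⊤ = ⊤ := Fin.ext (length_wordOf P)
  rw [wordLE_iff_hasWalk]
  constructor
  · intro h
    simpa only [RelEmbedding.coe_toRelHom, RelIso.coe_toRelEmbedding, he0, he1] using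
      h.map e.toRelEmbedding.toRelHom
  · intro h
    have := h.map e.symm.toRelEmbedding.toRelHom
    rwa [← he0, ← he1] at this

end Words

section Reach

variable {V : Type*} {D : Digraph V} {k : ℕ} {P : Digraph (Fin (k + 1))} {W : Word} {a b x y : V}

/-- The greatest vertex of the path `P` at which a walk from its first vertex following the word
`W` can end. Since the empty set has supremum `⊥`, the value is meaningful also when there is no
such walk. -/
noncomputable def reach (P : Digraph (Fin (k + 1))) (W : Word) : Fin (k + 1) :=
  sSup {u | HasWalk P W ⊥ u}

theorem le_reach {u : Fin (k + 1)} (h : HasWalk P W ⊥ u) : u ≤ reach P W :=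
  le_sSup h

theorem reach_nil (P : Digraph (Fin (k + 1))) : reach P [] = ⊥ := by
  simp [reach, HasWalk]

theorem IsPath.reach_concat (hP : IsPath P) (W : Word) (l : Letter) :
    reach P (W ++ [l]) ≤ reach P W ∨
      (reach P (W ++ [l])).val = reach P W + 1 ∧ Step P l (reach P W) (reach P (W ++ [l])) := by
  rcases Set.eq_empty_or_nonempty {u | HasWalk P (W ++ [l]) ⊥ u} with hempty | hne
  · exact .inl (by simp [reach, hempty])
  have hmem : HasWalk P (W ++ [l]) ⊥ (reach P (W ++ [l])) := hne.csSup_mem (Set.toFinite _)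
  obtain ⟨u, hu, hl⟩ := hasWalk_concat_iff.1 hmem
  have hle : u ≤ reach P W := le_reach hu
  rcases le_or_gt (reach P (W ++ [l])) (reach P W) with h | hlt
  · exact .inl h
  have hval : (reach P (W ++ [l])).val ≤ u + 1 := by
    rcases hl.adj_or_adj with h | h
    exacts [(hP.val_le_of_adj h).2, (hP.val_le_of_adj h).1]
  rw [Fin.le_def] at hle
  rw [Fin.lt_def] at hlt
  obtain rfl : u = reach P W := Fin.ext (by omega)
  exact .inr ⟨by omega, hl⟩

/-- The least reach in `P` of the words that can be walked in `D` from `a` to `x`. -/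
noncomputable def minReach (D : Digraph V) (a : V) (P : Digraph (Fin (k + 1))) (x : V) :
    Fin (k + 1) :=
  sInf (reach P '' {W | HasWalk D W a x})

theorem minReach_le (h : HasWalk D W a x) : minReach D a P x ≤ reach P W :=
  sInf_le (Set.mem_image_of_mem _ h)

theorem exists_reach_eq_minReach (P : Digraph (Fin (k + 1))) (h : ∃ W, HasWalk D W a x) :
    ∃ W, HasWalk D W a x ∧ reach P W = minReach D a P x :=
  (Set.Nonempty.image (reach P) h).csInf_mem (Set.toFinite _)

theorem IsPath.step_minReach (hP : IsPath P) (hx : ∃ W, HasWalk D W a x) {l : Letter}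
    (hl : Step D l x y) (hlt : minReach D a P x < minReach D a P y) :
    Step P l (minReach D a P x) (minReach D a P y) := by
  obtain ⟨W, hW, hreach⟩ := exists_reach_eq_minReach P hx
  have hle : minReach D a P y ≤ reach P (W ++ [l]) :=
    minReach_le (hasWalk_concat_iff.2 ⟨x, hW, hl⟩)
  rw [← hreach] at hlt ⊢
  rcases hP.reach_concat W l with h | ⟨hval, hstep⟩
  · exact absurd (hle.trans h) hlt.not_ge
  · have heq : minReach D a P y = reach P (W ++ [l]) :=
      Fin.ext (by rw [Fin.lt_def] at hlt; rw [Fin.le_def] at hle; omega)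
    rwa [heq]

theorem IsPath.minReach_adj (hP : IsPath P) (hconn : ∀ x, ∃ W, HasWalk D W a x) (h : D.Adj x y) :
    P.Adj (minReach D a P x) (minReach D a P y) := by
  rcases lt_trichotomy (minReach D a P x) (minReach D a P y) with hlt | heq | hgt
  · exact hP.step_minReach (l := .plus) (hconn x) h hlt
  · exact heq ▸ hP.1 _
  · exact hP.step_minReach (l := .minus) (hconn y) h hgt

theorem minReach_self (D : Digraph V) (a : V) (P : Digraph (Fin (k + 1))) :
    minReach D a P a = ⊥ :=
  le_bot_iff.1 (reach_nil P ▸ minReach_le (W := []) rfl)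

theorem IsPath.exists_hom_of_forall_hasWalk (hP : IsPath P) (hconn : ∀ x, ∃ W, HasWalk D W a x)
    (h : ∀ W, HasWalk D W a b → HasWalk P W ⊥ ⊤) :
    ∃ f : D.Adj →r P.Adj, f a = ⊥ ∧ f b = ⊤ := by
  refine ⟨⟨minReach D a P, hP.minReach_adj hconn⟩, minReach_self D a P, ?_⟩
  obtain ⟨W, hW, hreach⟩ := exists_reach_eq_minReach P (hconn b)
  exact top_le_iff.1 ((le_reach (h W hW)).trans_eq hreach)

end Reach

section Products

variable {ι : Type*} {k : ι → ℕ} {Q : ∀ i, Digraph (Fin (k i + 1))}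

theorem induction_on_covBy {α : Type*} [PartialOrder α] [OrderBot α] [Finite α] {p : α → Prop}
    (bot : p ⊥) (covBy : ∀ s t, s ⋖ t → p s → p t) (t : α) : p t := by
  classical
  have := Fintype.ofFinite α
  let := Fintype.toLocallyFiniteOrder (α := α)
  induction le_iff_reflTransGen_covBy.1 (bot_le (a := t)) with
  | refl => exact bot
  | tail _ hst ih => exact covBy _ _ hst ih

theorem prodDigraph_adj_inf (hQ : ∀ i, IsPath (Q i)) (t : ∀ i, Fin (k i + 1))
    {x y : ∀ i, Fin (k i + 1)} (h : (prodDigraph Q).Adj x y) :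
    (prodDigraph Q).Adj (x ⊓ t) (y ⊓ t) :=
  fun i => (hQ i).adj_inf (t i) (h i)

theorem prodDigraph_adj_inf_or_adj_inf_of_covBy (hQ : ∀ i, IsPath (Q i))
    {t t' x y : ∀ i, Fin (k i + 1)} (ht : t ⋖ t') (h : (prodDigraph Q).Adj x y) :
    (prodDigraph Q).Adj (x ⊓ t) (y ⊓ t') ∨ (prodDigraph Q).Adj (x ⊓ t') (y ⊓ t) := by
  obtain ⟨i, hi, heq⟩ := Pi.covBy_iff.1 ht
  have hinf (j) := (hQ j).adj_inf (t j) (h j)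
  refine ((hQ i).adj_inf_or_adj_inf_of_covBy hi (h i)).imp (fun hadj j => ?_) (fun hadj j => ?_)
  all_goals
    rcases eq_or_ne j i with rfl | hj
    · exact hadj
    · simpa only [Pi.inf_apply, ← heq j hj] using hinf j

variable [Finite ι]

theorem exists_hasWalk_prodDigraph (hQ : ∀ i, IsPath (Q i)) (x : ∀ i, Fin (k i + 1)) :
    ∃ W, HasWalk (prodDigraph Q) W ⊥ x := by
  induction x using induction_on_covBy with
  | bot => exact ⟨[], rfl⟩
  | covBy s t hst ih =>
    obtain ⟨W, hW⟩ := ih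
    have hrefl : (prodDigraph Q).Adj ⊤ ⊤ := fun i => (hQ i).1 _
    have hadj := prodDigraph_adj_inf_or_adj_inf_of_covBy hQ hst hrefl
    simp only [top_inf_eq] at hadj
    obtain ⟨l, hl⟩ := exists_step_of_adj_or_adj hadj
    exact ⟨W ++ [l], hasWalk_concat_iff.2 ⟨s, hW, hl⟩⟩

theorem exists_surjective_hom_of_forall_wordLE (hQ : ∀ i, IsPath (Q i)) {m : ℕ}
    {P : Digraph (Fin (m + 1))} (hP : IsPath P)
    (h : ∀ W, (∀ i, WordLE (wordOf (Q i)) W) → WordLE (wordOf P) W) :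
    ∃ f : (prodDigraph Q).Adj →r P.Adj, Function.Surjective f := by
  have hconn := exists_hasWalk_prodDigraph hQ
  obtain ⟨f, hbot, htop⟩ := hP.exists_hom_of_forall_hasWalk (b := ⊤) hconn fun W hW =>
    (wordLE_wordOf_iff hP).1 <| h W fun i =>
      (wordLE_wordOf_iff (hQ i)).2 (hasWalk_prodDigraph_iff.1 hW i)
  obtain ⟨W, hW⟩ := hconn ⊤
  exact ⟨f, hP.surjective_of_hasWalk f hW hbot htop⟩

end Products

section PathToWord

variable {n : ℕ} {G : Digraph (Fin n)}

theorem PathCondition.not_surjective (hG : PathCondition G) {ι : Type*} [Finite ι]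
    {Q : ι → Digraph (Fin (n - 2 + 1))} (hQ : ∀ i, IsPath (Q i) ∧ Embeds (Q i) G)
    (f : (prodDigraph Q).Adj →r G.Adj) : ¬ Function.Surjective f := by
  intro hf
  let e := Finite.equivFin ι
  let reindex : (prodDigraph (Q ∘ e.symm)).Adj →r (prodDigraph Q).Adj :=
    ⟨fun x i => x (e i), fun {x y} h i => by simpa using h (e i)⟩
  have hreindex : Function.Surjective reindex := fun x =>
    ⟨x ∘ e.symm, funext fun i => congrArg x (e.symm_apply_apply i)⟩
  exact hG ⟨_, Q ∘ e.symm, fun i => hQ _, f.comp reindex, hf.comp hreindex⟩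

theorem IsSubpath.exists_surjective_hom (hn : 1 ≤ n) (hG : ∀ v, G.Adj v v)
    {P : Digraph (Fin (n - 1 + 1))} (h : IsSubpath P G) :
    ∃ e : P.Adj →r G.Adj, Function.Surjective e := by
  obtain ⟨hP, e, he, hadj⟩ := h
  refine ⟨⟨e, fun {i j} hij => ?_⟩, (he.bijective_of_nat_card_le (by simp; omega)).2⟩
  by_cases heq : i = j
  · exact heq ▸ hG _
  · exact (hadj i j ((hP.2 i j heq).1 (.inl hij))).1 hij

theorem IsCycle.wordCondition_of_pathCondition (hG : IsCycle G) (h : PathCondition G) :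
    WordCondition G := by
  intro P hP
  by_contra! hword
  obtain ⟨e, he⟩ := hP.exists_surjective_hom (by have := hG.1; omega) hG.2.1
  let Q (R : {R : Digraph (Fin (n - 2 + 1)) // IsPath R ∧ Embeds R G}) := R.1
  obtain ⟨f, hf⟩ := exists_surjective_hom_of_forall_wordLE (Q := Q) (fun R => R.2.1) hP.1
    fun W hW => hword W fun R hR hRG => hW ⟨R, hR, hRG⟩
  exact h.not_surjective (Q := Q) (fun R => R.2) (e.comp f) (he.comp hf)

end PathToWord

section Lifts

open scoped Fin.CommRing

variable {n : ℕ} [NeZero n] {G : Digraph (Fin n)}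

theorem intCast_eq_intCast_iff_dvd {a b : ℤ} : (a : Fin n) = b ↔ (n : ℤ) ∣ b - a :=
  (CharP.intCast_eq_intCast (Fin n) n).trans Int.modEq_iff_dvd

namespace IsCycle

theorem adj_or_adj_iff (hG : IsCycle G) {u v : Fin n} (huv : u ≠ v) :
    G.Adj u v ∨ G.Adj v u ↔ v = u + 1 ∨ u = v + 1 := by
  rw [hG.2.2 u v huv]
  simp only [Fin.ext_iff, Fin.val_add, Fin.val_one', Nat.add_mod_mod]

theorem exists_intCast_eq_of_adj (hG : IsCycle G) {a : ℤ} {v : Fin n}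
    (h : G.Adj a v ∨ G.Adj v a) : ∃ b : ℤ, (b : Fin n) = v ∧ |b - a| ≤ 1 := by
  by_cases hav : (a : Fin n) = v
  · exact ⟨a, hav, by simp⟩
  rcases (hG.adj_or_adj_iff hav).1 h with h | h
  · exact ⟨a + 1, by rw [h]; push_cast; rfl, by simp⟩
  · exact ⟨a - 1, by push_cast; rw [h]; ring, by simp⟩

theorem abs_sub_le_one_of_adj (hG : IsCycle G) (hn : 4 ≤ n) {a b : ℤ} (h : G.Adj a b)
    (hab : |b - a| ≤ 2) : |b - a| ≤ 1 := by
  obtain ⟨c, hc, hca⟩ := hG.exists_intCast_eq_of_adj (.inl h)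
  have hcb : b - c = 0 := by
    refine Int.eq_zero_of_abs_lt_dvd (intCast_eq_intCast_iff_dvd.1 hc) ?_
    rw [abs_le] at hab hca
    rw [abs_lt]
    omega
  rwa [sub_eq_zero.1 hcb]

theorem intCast_adj_or_adj (hG : IsCycle G) (a : ℤ) :
    G.Adj a (a + 1 : ℤ) ∨ G.Adj (a + 1 : ℤ) a := by
  have hn : 3 ≤ n := hG.1
  refine (hG.adj_or_adj_iff fun heq => ?_).2 (.inl (by push_cast; rfl))
  have := Int.le_of_dvd (by omega) (intCast_eq_intCast_iff_dvd.1 heq)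
  omega

end IsCycle

/-- `F` lifts the map `g` to the universal cover `ℤ` of the `n`-cycle. -/
structure IsLift {V : Type*} (D : Digraph V) (g : V → Fin n) (F : V → ℤ) : Prop where
  cast_eq (x : V) : (F x : Fin n) = g x
  abs_sub_le_one {x y : V} : D.Adj x y → |F y - F x| ≤ 1

/-- For `4 ≤ n` homotopies lift: an arc of the cycle whose ends are represented by integers at
distance at most `2` has them at distance at most `1`, so lifting the single moves `g x ~ g' x`
yields a lift of `g'`. -/
theorem IsCycle.exists_isLift_of_homotopic (hG : IsCycle G) (hn : 4 ≤ n) {V : Type*}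
    {D : Digraph V} (hD : ∀ x, D.Adj x x) {g : V → Fin n} {F : V → ℤ} (hF : IsLift D g F)
    (g' : D.Adj →r G.Adj)
    (hgg' : ∀ {x y}, D.Adj x y → G.Adj (g x) (g' y) ∨ G.Adj (g' x) (g y)) :
    ∃ F', IsLift D g' F' := by
  have hmove (x) : ∃ b : ℤ, (b : Fin n) = g' x ∧ |b - F x| ≤ 1 :=
    hG.exists_intCast_eq_of_adj (by simpa only [hF.cast_eq] using hgg' (hD x))
  choose F' hF' hFF' using hmove
  refine ⟨F', hF', fun {x y} hxy => ?_⟩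
  have hx := abs_le.1 (hFF' x)
  have hy := abs_le.1 (hFF' y)
  have hxyF := abs_le.1 (hF.abs_sub_le_one hxy)
  refine hG.abs_sub_le_one_of_adj hn (by simpa only [hF'] using g'.map_rel hxy) ?_
  rcases hgg' hxy with h | h
  · have hdiag := abs_le.1 <| hG.abs_sub_le_one_of_adj hn (a := F x) (b := F' y)
      (by rwa [hF.cast_eq, hF']) (abs_le.2 (by omega))
    exact abs_le.2 (by omega)
  · have hdiag := abs_le.1 <| hG.abs_sub_le_one_of_adj hn (a := F' x) (b := F y)
      (by rwa [hF.cast_eq, hF']) (abs_le.2 (by omega))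
    exact abs_le.2 (by omega)

theorem IsCycle.exists_isLift_prodDigraph (hG : IsCycle G) (hn : 4 ≤ n) {ι : Type*} [Finite ι]
    {k : ι → ℕ} {Q : ∀ i, Digraph (Fin (k i + 1))} (hQ : ∀ i, IsPath (Q i))
    (f : (prodDigraph Q).Adj →r G.Adj) : ∃ F, IsLift (prodDigraph Q) f F := by
  -- Contract the product to the point `⊥` by truncating it at lower and lower bounds `t`.
  let trunc (t : ∀ i, Fin (k i + 1)) : (prodDigraph Q).Adj →r G.Adj :=
    ⟨fun x => f (x ⊓ t), fun h => f.map_rel (prodDigraph_adj_inf hQ t h)⟩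
  have hlift (t) : ∃ F, IsLift (prodDigraph Q) (trunc t) F := by
    induction t using induction_on_covBy with
    | bot => exact ⟨fun _ => (f ⊥).val, fun x => by simp [trunc], by simp⟩
    | covBy s t hst ih =>
      obtain ⟨F, hF⟩ := ih
      exact hG.exists_isLift_of_homotopic hn (fun x i => (hQ i).1 _) hF (trunc t) fun h =>
        (prodDigraph_adj_inf_or_adj_inf_of_covBy hQ hst h).imp f.map_rel f.map_rel
  simpa [trunc] using hlift ⊤

/-- The path of length `k` obtained by unrolling the cycle `G` from the integer `m`. -/
def unroll (G : Digraph (Fin n)) (m : ℤ) (k : ℕ) : Digraph (Fin (k + 1)) where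
  Adj i j := i.val ≤ j + 1 ∧ j.val ≤ i + 1 ∧ G.Adj (m + i.val : ℤ) (m + j.val : ℤ)

theorem IsCycle.isPath_unroll (hG : IsCycle G) (m : ℤ) (k : ℕ) : IsPath (unroll G m k) := by
  have hconsec {i j : Fin (k + 1)} (h : j.val = i + 1) :
      (unroll G m k).Adj i j ∨ (unroll G m k).Adj j i := by
    have hj : m + i.val + 1 = m + j.val := by omega
    exact (hj ▸ hG.intCast_adj_or_adj (m + i.val)).imp
      (⟨by omega, by omega, ·⟩) (⟨by omega, by omega, ·⟩)
  refine ⟨fun i => ⟨by omega, by omega, hG.2.1 _⟩, fun i j hij => ⟨fun h => ?_, ?_⟩⟩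
  · have hij' : i.val ≠ j := Fin.val_ne_of_ne hij
    rcases h with ⟨hi, hj, -⟩ | ⟨hi, hj, -⟩ <;> omega
  · rintro (h | h)
    exacts [hconsec h, (hconsec h).symm]

theorem IsCycle.isSubpath_unroll (hG : IsCycle G) (m : ℤ) : IsSubpath (unroll G m (n - 1)) G := by
  refine ⟨hG.isPath_unroll m _, fun i => (m + i.val : ℤ), fun i j hij => ?_, fun i j hij => ?_⟩
  · have := Int.eq_zero_of_abs_lt_dvd (intCast_eq_intCast_iff_dvd.1 hij)
      (abs_lt.2 (by have := hG.1; omega))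
    exact Fin.ext (by omega)
  · exact ⟨fun h => h.2.2, fun h => ⟨by omega, by omega, h⟩⟩

theorem IsLift.exists_hom_unroll {V : Type*} {D : Digraph V} {f : D.Adj →r G.Adj} {F : V → ℤ}
    (hF : IsLift D f F) (hG : ∀ v, G.Adj v v) {m : ℤ} (hm : ∀ x, m ≤ F x) (k : ℕ) :
    ∃ r : D.Adj →r (unroll G m k).Adj, ∀ x, (r x).val = min (F x - m).toNat k := by
  refine ⟨⟨fun x => ⟨min (F x - m).toNat k, by omega⟩, fun {x y} hxy => ?_⟩, fun _ => rfl⟩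
  have hxyF := abs_le.1 (hF.abs_sub_le_one hxy)
  have hx := hm x
  have hy := hm y
  refine ⟨by dsimp only; omega, by dsimp only; omega, ?_⟩
  by_cases heq : min (F x - m).toNat k = min (F y - m).toNat k
  · simpa only [heq] using hG _
  · have hFx : m + (min (F x - m).toNat k : ℕ) = F x := by omega
    have hFy : m + (min (F y - m).toNat k : ℕ) = F y := by omega
    simpa only [hFx, hFy, hF.cast_eq] using f.map_rel hxy

theorem IsLift.exists_add_le {V : Type*} {D : Digraph V} {f : V → Fin n} {F : V → ℤ}
    (hF : IsLift D f F) (hf : Function.Surjective f) {m : ℤ} (hm : ∀ x, m ≤ F x) :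
    ∃ x, m + (n - 1) ≤ F x := by
  obtain ⟨x, hx⟩ := hf (m - 1 : ℤ)
  have hdvd : (n : ℤ) ∣ F x - (m - 1) := intCast_eq_intCast_iff_dvd.1 (by rw [hF.cast_eq, hx])
  have := Int.le_of_dvd (by have := hm x; omega) hdvd
  exact ⟨x, by omega⟩

theorem IsCycle.pathCondition_of_wordCondition (hG : IsCycle G) (hn : 4 ≤ n)
    (h : WordCondition G) : PathCondition G := by
  rintro ⟨l, Q, hQ, f, hf⟩
  obtain ⟨F, hF⟩ := hG.exists_isLift_prodDigraph hn (fun i => (hQ i).1) f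
  obtain ⟨a, ha⟩ := Finite.exists_min F
  obtain ⟨b, hb⟩ := hF.exists_add_le hf ha
  obtain ⟨r, hr⟩ := hF.exists_hom_unroll hG.2.1 ha (n - 1)
  have hra : r a = ⊥ := Fin.ext (by simp [hr, bot_eq_zero])
  have hrb : r b = ⊤ := Fin.ext (by rw [hr, Fin.top_eq_last, Fin.val_last]; omega)
  obtain ⟨W, hWQ, hWP⟩ := h _ (hG.isSubpath_unroll (F a))
  have hwalk : HasWalk (prodDigraph Q) W a b := hasWalk_prodDigraph_iff.2 fun i => by
    obtain ⟨hpath, hembeds⟩ := hQ i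
    exact hpath.hasWalk_of_reverse ((wordLE_wordOf_iff hpath).1 (hWQ _ hpath hembeds))
      ((wordLE_wordOf_iff hpath.reverse).1 (hWQ _ hpath.reverse hembeds.reverse)) _ _
  exact hWP ((wordLE_wordOf_iff (hG.isPath_unroll _ _)).2 (hra ▸ hrb ▸ hwalk.map r))

end Lifts

section DirectedTriangle

theorem eq_or_eq_of_adj_bounds {V W : Type*} {D : Digraph V} {G : Digraph W}
    (hG : ∀ u v w, G.Adj u v → G.Adj v w → G.Adj u w → v = u ∨ v = w)
    (f : D.Adj →r G.Adj) {a b : V} (ha : ∀ x, D.Adj a x) (hb : ∀ x, D.Adj x b) (x : V) :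
    f x = f a ∨ f x = f b :=
  hG _ _ _ (f.map_rel (ha x)) (f.map_rel (hb x)) (f.map_rel (ha b))

theorem IsPath.exists_adj_bounds {P : Digraph (Fin 2)} (hP : IsPath P) :
    ∃ a b, (∀ x, P.Adj a x) ∧ ∀ x, P.Adj x b := by
  simp only [Fin.forall_fin_two]
  rcases hP.adj_or_adj (u := 0) (v := 1) rfl with h | h
  · exact ⟨0, 1, ⟨hP.1 _, h⟩, h, hP.1 _⟩
  · exact ⟨1, 0, ⟨h, hP.1 _⟩, hP.1 _, h⟩

theorem IsDirectedCycle.eq_or_eq_of_adj {G : Digraph (Fin 3)} (hG : IsDirectedCycle G)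
    (u v w : Fin 3) (huv : G.Adj u v) (hvw : G.Adj v w) (huw : G.Adj u w) : v = u ∨ v = w := by
  have hcyc : ∀ u v : Fin 3, v = u ∨ v.val = (u + 1) % 3 ∨ u.val = (v + 1) % 3 := by decide
  rcases hG.2 with h | h
  · have hsucc {u v : Fin 3} (huv : G.Adj u v) : v = u ∨ v.val = (u + 1) % 3 :=
      (hcyc u v).imp_right (Or.resolve_right · fun hvu => (h v u hvu).2 huv)
    have huv := hsucc huv
    have hvw := hsucc hvw
    have huw := hsucc huw
    omega
  · have hpred {u v : Fin 3} (huv : G.Adj u v) : v = u ∨ u.val = (v + 1) % 3 :=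
      (hcyc u v).imp_right (Or.resolve_left · fun huv' => (h u v huv').2 huv)
    have huv := hpred huv
    have hvw := hpred hvw
    have huw := hpred huw
    omega

theorem IsDirectedCycle.pathCondition {G : Digraph (Fin 3)} (hG : IsDirectedCycle G) :
    PathCondition G := by
  rintro ⟨l, Q, hQ, f, hf⟩
  choose a b ha hb using fun i => (hQ i).1.exists_adj_bounds
  have hsub : (Finset.univ : Finset (Fin 3)) ⊆ {f a, f b} := fun v _ => by
    obtain ⟨x, rfl⟩ := hf v
    simpa using
      eq_or_eq_of_adj_bounds hG.eq_or_eq_of_adj f (fun x i => ha i (x i)) (fun x i => hb i (x i)) x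
  have hcard : 3 ≤ 2 := (Finset.card_le_card hsub).trans Finset.card_le_two
  omega

end DirectedTriangle

end ReflexiveCycle

theorem theorem3p9 {n : ℕ} (G : Digraph (Fin n)) (hG : ReflexiveCycle.IsCycle G) :
    (ReflexiveCycle.PathCondition G → ReflexiveCycle.WordCondition G) ∧
    ((4 ≤ n ∨ ReflexiveCycle.IsDirectedCycle G) →
      (ReflexiveCycle.PathCondition G ↔ ReflexiveCycle.WordCondition G)) := by
  have h3 : 3 ≤ n := hG.1
  have : NeZero n := ⟨by omega⟩
  refine ⟨hG.wordCondition_of_pathCondition, fun h => ⟨hG.wordCondition_of_pathCondition, ?_⟩⟩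
  rcases h3.eq_or_lt with rfl | hn
  · exact fun _ => (h.resolve_left (by omega)).pathCondition
  · exact hG.pathCondition_of_wordCondition hn
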